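/- Let $m,r\ge 1$ be integers, let $n_1,\ldots,n_m$ be positive integers and $\tau_0,\tau_1,\ldots,\tau_m$ non-negative integers with $0\le\tau_0-\tau_m\le n_m$ and $n_m+\tau_m\ge\tau_{j+1}>n_j+\tau_j$ for $j=1,\ldots,m-1$. Put $N=\sum_{j=1}^m n_j$, let $\gamma$ be Euler's constant, and let $$S_n=\sum_{k=1}^n\left(\frac1k-\log\frac{k+1}{k}\right),\qquad \omega(t)=\frac{1}{t\left(\log^2(1/t-1)+\pi^2\right)}\quad(0<t<1).$$ Then $$\left|\frac{N!\,(-r)^N}{n_1!\cdots n_m!}\,\gamma-\sum_{k=0}^N(-1)^k\binom{N}{k}\binom{rk+n_1+\tau_1}{n_1}\cdots\binom{rk+n_m+\tau_m}{n_m}S_{rk+\tau_0}\right|$$ $$\le\prod_{j=1}^m\binom{n_m+\tau_m-\tau_j}{n_j}\int_0^1\!\!\int_0^1\frac{x^{n_m+\tau_m}(1-x^r)^N\,t^{n_m+\tau_m-\tau_0}(1-t)^{\tau_0-\tau_m}\,\omega(t)}{(1-t+xt)^{n_m+1}}\,dx\,dt,$$ where the double integral on the right converges absolutely. -/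

import Mathlib

open MeasureTheory

/-- The partial sums `S_n = ∑_{k=1}^n (1/k - log((k+1)/k))`, which converge to Euler's constant. -/
noncomputable def gammaPartialSum (n : ℕ) : ℝ :=
  ∑ k ∈ Finset.Icc 1 n, (1 / (k : ℝ) - Real.log (((k : ℝ) + 1) / (k : ℝ)))

/-- The weight `ω(t) = 1 / (t (log²(1/t - 1) + π²))` on `(0, 1)`. -/
noncomputable def omegaWeight (t : ℝ) : ℝ :=
  1 / (t * (Real.log (1 / t - 1) ^ 2 + Real.pi ^ 2))

/-- The integrand of the double integral, for parameters `n_1, …, n_m`, `τ_0, …, τ_m`, with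
`N = n_1 + … + n_m`. The natural number subtractions are exact when `τ_m ≤ τ_0 ≤ n_m + τ_m`. -/
noncomputable def errorIntegrand (m r : ℕ) (n τ : ℕ → ℕ) (x t : ℝ) : ℝ :=
  x ^ (n m + τ m) * (1 - x ^ r) ^ (∑ j ∈ Finset.Icc 1 m, n j) * t ^ (n m + τ m - τ 0)
    * (1 - t) ^ (τ 0 - τ m) * omegaWeight t / (1 - t + x * t) ^ (n m + 1)

/-- The linear form
`N! (-r)^N / (n_1! ⋯ n_m!) γ
  - ∑_{k=0}^N (-1)^k C(N,k) C(rk+n_1+τ_1, n_1) ⋯ C(rk+n_m+τ_m, n_m) S_{rk+τ_0}`,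
where `N = n_1 + … + n_m`. -/
noncomputable def gammaLinearForm (m r : ℕ) (n τ : ℕ → ℕ) : ℝ :=
  ((∑ j ∈ Finset.Icc 1 m, n j).factorial : ℝ) * (-(r : ℝ)) ^ (∑ j ∈ Finset.Icc 1 m, n j)
      / (∏ j ∈ Finset.Icc 1 m, ((n j).factorial : ℝ)) * Real.eulerMascheroniConstant
    - ∑ k ∈ Finset.range ((∑ j ∈ Finset.Icc 1 m, n j) + 1),
        (-1 : ℝ) ^ k * ((∑ j ∈ Finset.Icc 1 m, n j).choose k : ℝ)
          * (∏ j ∈ Finset.Icc 1 m, ((r * k + n j + τ j).choose (n j) : ℝ))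
          * gammaPartialSum (r * k + τ 0)

/-! The starting point is `γ - S_n = ∬ x^n ω(t) / (1 - t + x t) dx dt`
(`lintegral_lintegral_omegaWeight`). Let `C` be the union of the blocks `(τ_j, τ_j + n_j]`. They are
disjoint, so `C` has `N` elements, and `∏_{c ∈ C} (rk + c)` is `∏ n_j!` times the product of
binomials. The coefficients then sum to an `N`-th finite difference, equal to `N! (-r)^N`, so `∏
n_j!` times the linear form is the integral of `ω(t)` against `eulerIntegral` for `C`
(`prod_factorial_mul_gammaLinearForm`).

Each `c ∈ C` is an operator `x d/dx + c` applied to `(1 - x^r)^N`, and integration by parts removes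
it without boundary terms (`eulerIntegral_insert`). The last block is removed exactly: the part
above `τ_0` gives powers of `t`, the part below gives powers of `1 - t`. For the other blocks,
removing `c` costs at most a factor `p + 1 - c` with `p = n_m + τ_m` (`abs_eulerIntegral_le`); these
factors multiply to `n_j!` times the binomials of the bound. -/

/-! ### Euler polynomials and finite differences -/

/-- The polynomial `∑_k (-1)^k C(N,k) ∏_{c ∈ C} (rk + c) x^{rk}`, obtained from `(1 - x^r)^N` by
applying the Euler operators `x d/dx + c` for `c ∈ C`. -/
noncomputable def eulerPoly (r N : ℕ) (C : Finset ℕ) (x : ℝ) : ℝ :=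
  ∑ k ∈ Finset.range (N + 1),
    (-1 : ℝ) ^ k * (N.choose k : ℝ) * (∏ c ∈ C, ((r : ℝ) * k + c)) * x ^ (r * k)

/-- The integral of `eulerPoly` against `x^p / (1 - t + x t)^b`. -/
noncomputable def eulerIntegral (r N : ℕ) (t : ℝ) (C : Finset ℕ) (p b : ℕ) : ℝ :=
  ∫ x in (0 : ℝ)..1, eulerPoly r N C x * x ^ p / (1 - t + x * t) ^ b

lemma eulerPoly_empty (r N : ℕ) (x : ℝ) : eulerPoly r N ∅ x = (1 - x ^ r) ^ N := by
  rw [sub_eq_neg_add, add_pow]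
  refine Finset.sum_congr rfl fun k _ => ?_
  rw [neg_pow, Finset.prod_empty, pow_mul]
  ring

lemma sum_neg_one_pow_mul_choose_mul_eval (N : ℕ) (P : Polynomial ℝ) :
    ∑ k ∈ Finset.range (N + 1), (-1 : ℝ) ^ k * (N.choose k : ℝ) * P.eval (k : ℝ) =
      (-1) ^ N * (fwdDiff 1)^[N] P.eval 0 := by
  rw [fwdDiff_iter_eq_sum_shift, Finset.mul_sum]
  refine Finset.sum_congr rfl fun k hk => ?_
  have hk' : k ≤ N := Nat.lt_succ_iff.1 (Finset.mem_range.1 hk)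
  obtain ⟨q, rfl⟩ := Nat.exists_eq_add_of_le hk'
  have h : (-1 : ℝ) ^ q * (-1) ^ q = 1 := by rw [← mul_pow]; norm_num
  simp only [Nat.add_sub_cancel_left, zsmul_eq_mul, nsmul_eq_mul, zero_add, mul_one, pow_add]
  push_cast
  linear_combination (-((-1 : ℝ) ^ k * ((k + q).choose k : ℝ) * P.eval (k : ℝ))) * h

/-- The polynomial `∏_{c ∈ C} (r X + c)`. -/
noncomputable def linearProd (r : ℕ) (C : Finset ℕ) : Polynomial ℝ :=
  ∏ c ∈ C, (Polynomial.C (r : ℝ) * Polynomial.X + Polynomial.C (c : ℝ))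

lemma linearProd_eval (r : ℕ) (C : Finset ℕ) (x : ℝ) :
    (linearProd r C).eval x = ∏ c ∈ C, ((r : ℝ) * x + c) := by
  simp [linearProd, Polynomial.eval_prod]

/-- An `N`-th difference kills polynomials of degree below `N`. This removes the boundary term at `x
= 1` in the integrations by parts. -/
lemma eulerPoly_one (r N : ℕ) (C : Finset ℕ) (hC : C.card < N) : eulerPoly r N C 1 = 0 := by
  have hdeg : (linearProd r C).natDegree < N := by
    refine lt_of_le_of_lt ((Polynomial.natDegree_prod_le _ _).trans
      (Finset.sum_le_card_nsmul _ _ 1 fun c _ => Polynomial.natDegree_linear_le)) ?_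
    simpa using hC
  have h := sum_neg_one_pow_mul_choose_mul_eval N (linearProd r C)
  rw [Polynomial.fwdDiff_iter_eq_zero_of_degree_lt hdeg] at h
  simpa [eulerPoly, linearProd_eval] using h

lemma sum_neg_one_pow_mul_choose_mul_prod {r : ℕ} (hr : 1 ≤ r) (C : Finset ℕ) :
    ∑ k ∈ Finset.range (C.card + 1),
      (-1 : ℝ) ^ k * (C.card.choose k : ℝ) * ∏ c ∈ C, ((r : ℝ) * k + c) =
      (C.card.factorial : ℝ) * (-(r : ℝ)) ^ C.card := by
  have hr' : (r : ℝ) ≠ 0 := by positivity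
  have hdeg : (linearProd r C).natDegree = C.card := by
    rw [linearProd, Polynomial.natDegree_prod _ _ fun c _ =>
      Polynomial.leadingCoeff_ne_zero.1 (by rwa [Polynomial.leadingCoeff_linear hr'])]
    rw [Finset.sum_congr rfl fun c _ => Polynomial.natDegree_linear hr', Finset.card_eq_sum_ones]
  have hlead : (linearProd r C).leadingCoeff = (r : ℝ) ^ C.card := by
    rw [linearProd, Polynomial.leadingCoeff_prod,
      Finset.prod_congr rfl fun c _ => Polynomial.leadingCoeff_linear hr', Finset.prod_const]
  have h := sum_neg_one_pow_mul_choose_mul_eval C.card (linearProd r C)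
  have h2 := Polynomial.fwdDiff_iter_degree_eq_factorial (linearProd r C)
  rw [hdeg, hlead] at h2
  simp only [← linearProd_eval]
  rw [h, h2, neg_pow (r : ℝ), Pi.smul_apply, Pi.natCast_apply, smul_eq_mul]
  ring

lemma continuous_eulerPoly (r N : ℕ) (C : Finset ℕ) : Continuous (eulerPoly r N C) := by
  unfold eulerPoly
  fun_prop

lemma one_sub_add_mul_pos {t x : ℝ} (ht : t ∈ Set.Ioo (0 : ℝ) 1) (hx : 0 ≤ x) :
    0 < 1 - t + x * t := by
  have := mul_nonneg hx ht.1.le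
  linarith [ht.2]

lemma intervalIntegrable_eulerIntegrand (r N : ℕ) {t : ℝ} (ht : t ∈ Set.Ioo (0 : ℝ) 1)
    (C : Finset ℕ) (p b : ℕ) :
    IntervalIntegrable (fun x => eulerPoly r N C x * x ^ p / (1 - t + x * t) ^ b) volume 0 1 := by
  refine ContinuousOn.intervalIntegrable fun x hx => ContinuousAt.continuousWithinAt ?_
  rw [Set.uIcc_of_le zero_le_one] at hx
  have h := (one_sub_add_mul_pos ht hx.1).ne'
  have := (continuous_eulerPoly r N C).continuousAt (x := x)
  fun_prop (disch := positivity)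

lemma mul_eulerPoly_deriv (r N : ℕ) (C : Finset ℕ) {c : ℕ} (hc : c ∉ C) (x : ℝ) :
    ∃ d, HasDerivAt (eulerPoly r N C) d x ∧
      x * d = eulerPoly r N (insert c C) x - c * eulerPoly r N C x := by
  refine ⟨_, HasDerivAt.fun_sum fun k _ => ((hasDerivAt_pow (r * k) x).const_mul _), ?_⟩
  unfold eulerPoly
  rw [Finset.mul_sum, Finset.mul_sum, ← Finset.sum_sub_distrib]
  refine Finset.sum_congr rfl fun k _ => ?_
  rw [Finset.prod_insert hc]
  -- The derivative carries the truncated exponent `r * k - 1`, so constant terms are treated apart.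
  rcases Nat.eq_zero_or_pos (r * k) with h | h
  · have h' : (r : ℝ) * k = 0 := by exact_mod_cast h
    simp [h, h']
    ring
  · obtain ⟨q, hq⟩ := Nat.exists_eq_succ_of_ne_zero h.ne'
    have h' : (r : ℝ) * k = q + 1 := by exact_mod_cast hq
    rw [hq, h']
    simp
    ring

/-! ### Removing Euler operators by integration by parts -/

/-- Integration by parts. -/
lemma eulerIntegral_insert (r N : ℕ) {t : ℝ} (ht : t ∈ Set.Ioo (0 : ℝ) 1) {C : Finset ℕ} {c : ℕ}
    (hc : c ∉ C) (hC : C.card < N) (p b : ℕ) :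
    eulerIntegral r N t (insert c C) p b =
      (c - 1 - p) * eulerIntegral r N t C p b
        + b * (t * eulerIntegral r N t C (p + 1) (b + 1)) := by
  have hint := intervalIntegrable_eulerIntegrand r N ht
  have key : ∫ x in (0 : ℝ)..1, (eulerPoly r N (insert c C) x * x ^ p / (1 - t + x * t) ^ b
      - ((c - 1 - p) * (eulerPoly r N C x * x ^ p / (1 - t + x * t) ^ b)
        + b * (t * (eulerPoly r N C x * x ^ (p + 1) / (1 - t + x * t) ^ (b + 1))))) = 0 := by
    -- The extra factor `x` in `x ^ (p + 1)` turns `d/dx` into `x d/dx` and makes the primitive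
    -- vanish at `0` even when `p = 0`.
    rw [intervalIntegral.integral_eq_sub_of_hasDerivAt
      (f := fun x => eulerPoly r N C x * x ^ (p + 1) / (1 - t + x * t) ^ b)]
    · simp [eulerPoly_one r N C hC]
    · intro x hx
      rw [Set.uIcc_of_le zero_le_one] at hx
      have hpos := one_sub_add_mul_pos ht hx.1
      obtain ⟨d, hd, hxd⟩ := mul_eulerPoly_deriv r N C hc x
      have hden : HasDerivAt (fun x : ℝ => 1 - t + x * t) t x := by
        simpa using ((hasDerivAt_id x).mul_const t).const_add (1 - t)
      refine ((hd.mul (hasDerivAt_pow (p + 1) x)).div (hden.pow b)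
        (pow_ne_zero b hpos.ne')).congr_deriv ?_
      have hD : eulerPoly r N (insert c C) x = x * d + c * eulerPoly r N C x := by linarith
      rw [hD]
      rcases b with _ | b
      · simp
        ring
      · simp only [Nat.add_sub_cancel, Pi.pow_apply, Pi.mul_apply]
        generalize 1 - t + x * t = D at hpos
        field_simp
        push_cast
        ring
    · exact (hint _ p b).sub (((hint C p b).const_mul _).add
        (((hint C (p + 1) (b + 1)).const_mul _).const_mul _))
  rw [intervalIntegral.integral_sub (hint _ p b) (((hint C p b).const_mul _).add
        (((hint C (p + 1) (b + 1)).const_mul _).const_mul _)),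
    intervalIntegral.integral_add ((hint C p b).const_mul _)
        (((hint C (p + 1) (b + 1)).const_mul _).const_mul _)] at key
  simp only [intervalIntegral.integral_const_mul] at key
  unfold eulerIntegral
  linarith

/-- Write `x t` as the denominator `1 - t + x t` minus `1 - t`. -/
lemma mul_eulerIntegral_succ_succ (r N : ℕ) {t : ℝ} (ht : t ∈ Set.Ioo (0 : ℝ) 1) (C : Finset ℕ)
    (p b : ℕ) :
    t * eulerIntegral r N t C (p + 1) (b + 1) =
      eulerIntegral r N t C p b - (1 - t) * eulerIntegral r N t C p (b + 1) := by
  have hint := intervalIntegrable_eulerIntegrand r N ht C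
  unfold eulerIntegral
  rw [← intervalIntegral.integral_const_mul, ← intervalIntegral.integral_const_mul,
    ← intervalIntegral.integral_sub (hint p b) ((hint p (b + 1)).const_mul _)]
  refine intervalIntegral.integral_congr fun x hx => ?_
  rw [Set.uIcc_of_le zero_le_one] at hx
  have hpos := one_sub_add_mul_pos ht hx.1
  obtain ⟨D, hD⟩ : ∃ D, D = 1 - t + x * t := ⟨_, rfl⟩
  simp only [← hD] at hpos ⊢
  field_simp
  rw [hD]
  ring

lemma eulerIntegral_union_Ioc_up (r N : ℕ) {t : ℝ} (ht : t ∈ Set.Ioo (0 : ℝ) 1) {C : Finset ℕ}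
    (q : ℕ) : ∀ (p b : ℕ), Disjoint C (Finset.Ioc p (p + q)) → C.card + q ≤ N →
    b.factorial * eulerIntegral r N t (C ∪ Finset.Ioc p (p + q)) p (b + 1) =
      (b + q).factorial * t ^ q * eulerIntegral r N t C (p + q) (b + q + 1) := by
  induction q with
  | zero => intro p b _ _; simp
  | succ q ih =>
    intro p b hd hcard
    have hI : Finset.Ioc p (p + (q + 1)) = insert (p + 1) (Finset.Ioc (p + 1) (p + 1 + q)) := by
      ext i; simp only [Finset.mem_Ioc, Finset.mem_insert]; omega
    rw [hI, Finset.disjoint_insert_right] at hd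
    have hcard' : (C ∪ Finset.Ioc (p + 1) (p + 1 + q)).card < N := by
      have := Finset.card_union_le C (Finset.Ioc (p + 1) (p + 1 + q))
      simp only [Nat.card_Ioc] at this
      omega
    -- For `c = p + 1` the coefficient `c - 1 - p` vanishes, and only the term with the factor `t`
    -- survives.
    rw [hI, Finset.union_insert, eulerIntegral_insert r N ht (by simp [hd.1]) hcard']
    have h := ih (p + 1) (b + 1) hd.2 (by omega)
    rw [show p + (q + 1) = p + 1 + q by ring, show b + (q + 1) = b + 1 + q by ring, pow_succ]
    rw [Nat.factorial_succ] at h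
    push_cast at h ⊢
    linear_combination t * h

lemma eulerIntegral_union_Ioc_down (r N : ℕ) {t : ℝ} (ht : t ∈ Set.Ioo (0 : ℝ) 1) {C : Finset ℕ}
    (s e : ℕ) : ∀ b : ℕ, Disjoint C (Finset.Ioc s (s + e)) → C.card + e ≤ N →
    b.factorial * eulerIntegral r N t (C ∪ Finset.Ioc s (s + e)) (s + e + b) (b + 1) =
      (b + e).factorial * (-(1 - t)) ^ e * eulerIntegral r N t C (s + e + b) (b + e + 1) := by
  induction e with
  | zero => intro b _ _; simp
  | succ e ih =>
    intro b hd hcard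
    have hI : Finset.Ioc s (s + (e + 1)) = insert (s + e + 1) (Finset.Ioc s (s + e)) := by
      ext i; simp only [Finset.mem_Ioc, Finset.mem_insert]; omega
    rw [hI, Finset.disjoint_insert_right] at hd
    have hcard' : (C ∪ Finset.Ioc s (s + e)).card < N := by
      have := Finset.card_union_le C (Finset.Ioc s (s + e))
      simp only [Nat.card_Ioc] at this
      omega
    -- Here `c - 1 - p = -(b + 1)` cancels the integral with the lower denominator power, leaving
    -- the factor `-(1 - t)` and the same `p`.
    rw [hI, Finset.union_insert, eulerIntegral_insert r N ht (by simp [hd.1]) hcard',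
      mul_eulerIntegral_succ_succ r N ht]
    have h := ih (b + 1) hd.2 (by omega)
    rw [show s + e + (b + 1) = s + (e + 1) + b by ring, Nat.factorial_succ] at h
    rw [show b + (e + 1) = b + 1 + e by ring, pow_succ]
    push_cast at h ⊢
    linear_combination (-(1 - t)) * h

lemma eulerIntegral_empty_nonneg (r N : ℕ) {t : ℝ} (ht : t ∈ Set.Ioo (0 : ℝ) 1) (p b : ℕ) :
    0 ≤ eulerIntegral r N t ∅ p b := by
  refine intervalIntegral.integral_nonneg zero_le_one fun x hx => ?_
  have hpos := one_sub_add_mul_pos ht hx.1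
  have h1 : 0 ≤ 1 - x ^ r := sub_nonneg.2 (pow_le_one₀ hx.1 hx.2)
  have := hx.1
  rw [eulerPoly_empty]
  positivity

lemma one_sub_mul_eulerIntegral_empty_le (r N : ℕ) {t : ℝ} (ht : t ∈ Set.Ioo (0 : ℝ) 1)
    (p b : ℕ) : (1 - t) * eulerIntegral r N t ∅ p (b + 1) ≤ eulerIntegral r N t ∅ p b := by
  have h1 := mul_eulerIntegral_succ_succ r N ht ∅ p b
  have h2 := mul_nonneg ht.1.le (eulerIntegral_empty_nonneg r N ht (p + 1) (b + 1))
  linarith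

lemma abs_eulerIntegral_le (r N : ℕ) {t : ℝ} (ht : t ∈ Set.Ioo (0 : ℝ) 1) (p : ℕ)
    (C : Finset ℕ) : ∀ b : ℕ, (∀ c ∈ C, c + b ≤ p + 1) → C.card ≤ N →
    |eulerIntegral r N t C p b| ≤ (∏ c ∈ C, ((p : ℝ) + 1 - c)) * eulerIntegral r N t ∅ p b := by
  -- Each removal may raise `b` by one. Taking the largest `c` first preserves `c + b ≤ p + 1`, as
  -- the remaining elements are smaller by at least one.
  induction C using Finset.induction_on_max with
  | empty => intro b _ _; simp [abs_of_nonneg (eulerIntegral_empty_nonneg r N ht p b)]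
  | insert c C hmax ih =>
    intro b hb hcard
    have hc : c ∉ C := fun h => lt_irrefl _ (hmax c h)
    rw [Finset.card_insert_of_notMem hc] at hcard
    have hcb : (c : ℝ) + b ≤ p + 1 := by exact_mod_cast hb c (Finset.mem_insert_self c C)
    rw [Finset.prod_insert hc, eulerIntegral_insert r N ht hc hcard,
      mul_eulerIntegral_succ_succ r N ht]
    have h1 := ih b (fun d hd => hb d (Finset.mem_insert_of_mem hd)) (by omega)
    have h2 := ih (b + 1) (fun d hd => by
      have := hmax d hd
      have := hb c (Finset.mem_insert_self c C)
      omega) (by omega)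
    have h3 := one_sub_mul_eulerIntegral_empty_le r N ht p b
    have hP : 0 ≤ ∏ c ∈ C, ((p : ℝ) + 1 - c) := Finset.prod_nonneg fun d hd => by
      have : (d : ℝ) + b ≤ p + 1 := by exact_mod_cast hb d (Finset.mem_insert_of_mem hd)
      have := Nat.cast_nonneg (α := ℝ) b
      linarith
    have ht1 : 0 ≤ 1 - t := by linarith [ht.2]
    set P := ∏ c ∈ C, ((p : ℝ) + 1 - c)
    set A := eulerIntegral r N t C p b
    set B := eulerIntegral r N t C p (b + 1)
    -- After a sign change both coefficients are nonnegative; since `(1 - t) B ≤ A` for the empty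
    -- set, they add up to `p + 1 - c`.
    calc |((c : ℝ) - 1 - p) * A + b * (A - (1 - t) * B)|
        = |((p : ℝ) + 1 - (c + b)) * A + b * ((1 - t) * B)| := by
          rw [← abs_neg]; congr 1; ring
      _ ≤ ((p : ℝ) + 1 - (c + b)) * |A| + b * ((1 - t) * |B|) := by
          refine (abs_add_le _ _).trans_eq ?_
          rw [abs_mul, abs_mul, abs_mul, abs_of_nonneg (sub_nonneg.2 hcb), abs_of_nonneg ht1,
            Nat.abs_cast]
      _ ≤ ((p : ℝ) + 1 - (c + b)) * (P * eulerIntegral r N t ∅ p b)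
            + b * ((1 - t) * (P * eulerIntegral r N t ∅ p (b + 1))) := by
          have := sub_nonneg.2 hcb
          gcongr
      _ = ((p : ℝ) + 1 - (c + b)) * (P * eulerIntegral r N t ∅ p b)
            + b * (P * ((1 - t) * eulerIntegral r N t ∅ p (b + 1))) := by ring
      _ ≤ ((p : ℝ) + 1 - (c + b)) * (P * eulerIntegral r N t ∅ p b)
            + b * (P * eulerIntegral r N t ∅ p b) := by gcongr
      _ = _ := by ring

/-! ### Double integral for `γ - S_n` -/

lemma lintegral_beta_one_sub {a : ℝ} (ha : a ∈ Set.Ioo (0 : ℝ) 1) :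
    ∫⁻ u in Set.Ioo (0 : ℝ) 1,
      ENNReal.ofReal (Real.sin (Real.pi * a) / Real.pi * (u ^ (a - 1) * (1 - u) ^ (-a))) = 1 := by
  have h := ProbabilityTheory.lintegral_betaPDF_eq_one ha.1 (sub_pos.2 ha.2)
  rw [ProbabilityTheory.lintegral_betaPDF] at h
  rw [← h]
  refine setLIntegral_congr_fun measurableSet_Ioo fun u _ => ?_
  have hb : ProbabilityTheory.beta a (1 - a) = Real.pi / Real.sin (Real.pi * a) := by
    rw [ProbabilityTheory.beta, Real.Gamma_mul_Gamma_one_sub]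
    simp
  rw [hb, one_div_div, show 1 - a - 1 = -a by ring, mul_assoc]

/-- The Möbius substitution `u = x t / (1 - t + x t)` in the beta integral. -/
lemma lintegral_beta_one_sub_div {a x : ℝ} (ha : a ∈ Set.Ioo (0 : ℝ) 1)
    (hx : x ∈ Set.Ioo (0 : ℝ) 1) :
    ∫⁻ t in Set.Ioo (0 : ℝ) 1,
      ENNReal.ofReal (Real.sin (Real.pi * a) / Real.pi *
        (x ^ a * (t ^ (a - 1) * (1 - t) ^ (-a)) / (1 - t + x * t))) = 1 := by
  have hx0 := hx.1
  have hD : ∀ {t : ℝ}, t ∈ Set.Ioo (0 : ℝ) 1 → 0 < 1 - t + x * t :=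
    fun ht => one_sub_add_mul_pos ht hx.1.le
  have himg : (fun t : ℝ => x * t / (1 - t + x * t)) '' Set.Ioo 0 1 = Set.Ioo 0 1 := by
    ext u
    constructor
    · rintro ⟨t, ht, rfl⟩
      have := hD ht
      have := ht.1
      refine ⟨by positivity, ?_⟩
      rw [div_lt_one (hD ht)]
      linarith [ht.2]
    · intro hu
      have hux : 0 < x + u * (1 - x) := by
        have := mul_pos hu.1 (sub_pos.2 hx.2)
        linarith
      refine ⟨u / (x + u * (1 - x)), ⟨div_pos hu.1 hux, ?_⟩, ?_⟩
      · rw [div_lt_one hux]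
        nlinarith [mul_pos hx.1 (sub_pos.2 hu.2)]
      · have h1 : 1 - u / (x + u * (1 - x)) + x * (u / (x + u * (1 - x)))
            = x / (x + u * (1 - x)) := by
          field_simp
          ring
        simp only [h1]
        field_simp
  have hderiv : ∀ t ∈ Set.Ioo (0 : ℝ) 1,
      HasDerivWithinAt (fun t : ℝ => x * t / (1 - t + x * t)) (x / (1 - t + x * t) ^ 2)
        (Set.Ioo 0 1) t := by
    intro t ht
    have h1 : HasDerivAt (fun t : ℝ => x * t) x t := by
      simpa using (hasDerivAt_id t).const_mul x
    have h2 : HasDerivAt (fun t : ℝ => 1 - t + x * t) (-1 + x) t :=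
      ((hasDerivAt_id t).const_sub 1).add h1
    refine ((h1.div h2 (hD ht).ne').congr_deriv ?_).hasDerivWithinAt
    congr 1
    ring
  have hinj : Set.InjOn (fun t : ℝ => x * t / (1 - t + x * t)) (Set.Ioo 0 1) := by
    intro s hs t ht hst
    simp only at hst
    rw [div_eq_div_iff (hD hs).ne' (hD ht).ne'] at hst
    have : x * (s - t) = 0 := by linear_combination hst
    rcases mul_eq_zero.1 this with h | h
    · exact absurd h hx0.ne'
    · linarith
  have key := lintegral_image_eq_lintegral_abs_deriv_mul measurableSet_Ioo hderiv hinj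
    fun u => ENNReal.ofReal
      (Real.sin (Real.pi * a) / Real.pi * (u ^ (a - 1) * (1 - u) ^ (-a)))
  rw [himg, lintegral_beta_one_sub ha] at key
  rw [key]
  refine setLIntegral_congr_fun measurableSet_Ioo fun t ht => ?_
  have ht0 := ht.1
  have ht1 := sub_pos.2 ht.2
  have hDt := hD ht
  have h1 : 1 - x * t / (1 - t + x * t) = (1 - t) / (1 - t + x * t) := by
    field_simp
    ring
  simp only [h1]
  rw [← ENNReal.ofReal_mul (abs_nonneg _), abs_of_pos (by positivity)]
  congr 1
  generalize 1 - t + x * t = D at hDt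
  rw [Real.div_rpow (by positivity) hDt.le, Real.div_rpow ht1.le hDt.le,
    Real.mul_rpow hx0.le ht0.le]
  have hx' : x ^ a = x ^ (a - 1) * x := by
    rw [← Real.rpow_add_one hx0.ne']; ring_nf
  have hD' : D ^ (a - 1) * D ^ (-a) * D = 1 := by
    rw [← Real.rpow_add hDt, ← Real.rpow_add_one hDt.ne']; ring_nf; simp
  have e1 := (Real.rpow_pos_of_pos hDt (a - 1)).ne'
  have e2 := (Real.rpow_pos_of_pos hDt (-a)).ne'
  have hpi := Real.pi_ne_zero
  rw [hx']
  field_simp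
  linear_combination Real.sin (Real.pi * a) * hD'

/-- A nonnegative kernel whose integral over `a` is `ω(t) / (1 - t + x t)` and whose integral
over `t` is `(1 - x ^ (1 - a)) / (1 - x)`. -/
noncomputable def gammaKernel (a x t : ℝ) : ℝ :=
  Real.sin (Real.pi * a) / Real.pi * (t ^ (a - 1) * (1 - t) ^ (1 - a)) / (1 - t + x * t)

lemma sin_pi_mul_div_pi_pos {a : ℝ} (ha : a ∈ Set.Ioo (0 : ℝ) 1) :
    0 < Real.sin (Real.pi * a) / Real.pi :=
  div_pos (Real.sin_pos_of_pos_of_lt_pi (mul_pos Real.pi_pos ha.1)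
    (mul_lt_of_lt_one_right Real.pi_pos ha.2)) Real.pi_pos

/-- Because `(1 - x)(1 - t) + x = 1 - t + x t`, the beta density is `1 - x` times the kernel plus `x
^ (1 - a)` times the Möbius-transformed density; both densities have mass one. -/
lemma lintegral_gammaKernel_right {a x : ℝ} (ha : a ∈ Set.Ioo (0 : ℝ) 1)
    (hx : x ∈ Set.Ioo (0 : ℝ) 1) :
    ∫⁻ t in Set.Ioo (0 : ℝ) 1, ENNReal.ofReal (gammaKernel a x t) =
      ENNReal.ofReal ((1 - x ^ (1 - a)) / (1 - x)) := by
  have hx0 := hx.1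
  have hx1 := sub_pos.2 hx.2
  have hc := sin_pi_mul_div_pi_pos ha
  have hsum : ENNReal.ofReal (1 - x) * (∫⁻ t in Set.Ioo (0 : ℝ) 1,
      ENNReal.ofReal (gammaKernel a x t)) + ENNReal.ofReal (x ^ (1 - a)) = 1 := by
    rw [← lintegral_beta_one_sub ha]
    conv_lhs => rw [← mul_one (ENNReal.ofReal (x ^ (1 - a))), ← lintegral_beta_one_sub_div ha hx]
    rw [← lintegral_const_mul' _ _ ENNReal.ofReal_ne_top,
      ← lintegral_const_mul' _ _ ENNReal.ofReal_ne_top, ← lintegral_add_right]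
    · refine setLIntegral_congr_fun measurableSet_Ioo fun t ht => ?_
      have ht0 := ht.1
      have ht1 := sub_pos.2 ht.2
      have hD := one_sub_add_mul_pos ht hx0.le
      simp only [gammaKernel]
      rw [← ENNReal.ofReal_mul hx1.le, ← ENNReal.ofReal_mul (by positivity),
        ← ENNReal.ofReal_add (by positivity) (by positivity)]
      congr 1
      have e1 : x ^ (1 - a) * x ^ a = x := by
        rw [← Real.rpow_add hx0]; simp
      have e2 : (1 - t) ^ (1 - a) = (1 - t) ^ (-a) * (1 - t) := by
        rw [← Real.rpow_add_one ht1.ne']; ring_nf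
      rw [e2]
      generalize Real.sin (Real.pi * a) / Real.pi = c
      generalize (1 - t) ^ (-a) = v
      generalize t ^ (a - 1) = u
      obtain ⟨D, hDD⟩ : ∃ D, D = 1 - t + x * t := ⟨_, rfl⟩
      simp only [← hDD] at hD ⊢
      field_simp
      rw [hDD]
      linear_combination c * u * v * e1
    · fun_prop
  have h1 : ENNReal.ofReal (1 - x) * (∫⁻ t in Set.Ioo (0 : ℝ) 1,
      ENNReal.ofReal (gammaKernel a x t)) = ENNReal.ofReal (1 - x ^ (1 - a)) := by
    rw [ENNReal.ofReal_sub 1 (by positivity : 0 ≤ x ^ (1 - a)), ENNReal.ofReal_one]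
    exact ENNReal.eq_sub_of_add_eq ENNReal.ofReal_ne_top hsum
  rw [ENNReal.ofReal_div_of_pos hx1, ← h1]
  rw [mul_comm, ENNReal.mul_div_cancel_right (by simpa using hx.2) ENNReal.ofReal_ne_top]

lemma integral_sin_pi_mul_exp (L : ℝ) :
    ∫ a in (0 : ℝ)..1, Real.sin (Real.pi * a) / Real.pi * Real.exp ((1 - a) * L) =
      (1 + Real.exp L) / (L ^ 2 + Real.pi ^ 2) := by
  have hpi := Real.pi_pos
  have hden : L ^ 2 + Real.pi ^ 2 ≠ 0 := by positivity
  rw [intervalIntegral.integral_eq_sub_of_hasDerivAt (f := fun a : ℝ =>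
    -(Real.exp ((1 - a) * L) * (L * Real.sin (Real.pi * a) + Real.pi * Real.cos (Real.pi * a)))
      / (Real.pi * (L ^ 2 + Real.pi ^ 2)))]
  · simp
    field_simp
    ring
  · intro a _
    have h1 : HasDerivAt (fun a : ℝ => Real.pi * a) Real.pi a := by
      simpa using (hasDerivAt_id a).const_mul Real.pi
    have h2 : HasDerivAt (fun a : ℝ => (1 - a) * L) (-1 * L) a :=
      ((hasDerivAt_id a).const_sub 1).mul_const L
    refine (((h2.exp.mul ((h1.sin.const_mul L).add (h1.cos.const_mul Real.pi))).neg).div_const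
      _).congr_deriv ?_
    simp only [Pi.add_apply]
    field_simp
    ring
  · exact Continuous.intervalIntegrable (by fun_prop) _ _

lemma omegaWeight_pos {t : ℝ} (ht : t ∈ Set.Ioo (0 : ℝ) 1) : 0 < omegaWeight t := by
  have := ht.1
  have := Real.pi_pos
  unfold omegaWeight
  positivity

/-- With `L = log (1/t - 1)` the kernel is `sin(πa)/π · exp((1 - a) L)` over the denominator, and `1
+ exp L = 1/t` supplies the `1/t` in `ω`. -/
lemma lintegral_gammaKernel_left {x t : ℝ} (hx : x ∈ Set.Ioo (0 : ℝ) 1)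
    (ht : t ∈ Set.Ioo (0 : ℝ) 1) :
    ∫⁻ a in Set.Ioo (0 : ℝ) 1, ENNReal.ofReal (gammaKernel a x t) =
      ENNReal.ofReal (omegaWeight t / (1 - t + x * t)) := by
  have ht0 := ht.1
  have ht1 := sub_pos.2 ht.2
  have hD := one_sub_add_mul_pos ht hx.1.le
  have hs : 1 / t - 1 = (1 - t) / t := by field_simp
  have hspos : 0 < 1 / t - 1 := by rw [hs]; positivity
  have heq : ∀ a : ℝ, gammaKernel a x t = (Real.sin (Real.pi * a) / Real.pi *
      Real.exp ((1 - a) * Real.log (1 / t - 1))) / (1 - t + x * t) := by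
    intro a
    rw [gammaKernel, mul_comm (1 - a) (Real.log _), ← Real.rpow_def_of_pos hspos, hs,
      Real.div_rpow ht1.le ht0.le, show a - 1 = -(1 - a) by ring, Real.rpow_neg ht0.le]
    ring
  rw [← ofReal_integral_eq_lintegral_ofReal]
  · rw [← integral_Ioc_eq_integral_Ioo, ← intervalIntegral.integral_of_le zero_le_one]
    simp only [heq]
    rw [intervalIntegral.integral_div, integral_sin_pi_mul_exp, Real.exp_log hspos]
    congr 2
    have := Real.pi_pos
    rw [omegaWeight]
    field_simp
    ring
  · simp only [heq]
    exact (Continuous.integrableOn_Icc (by fun_prop)).mono_set Set.Ioo_subset_Icc_self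
  · refine ae_restrict_of_forall_mem measurableSet_Ioo fun a ha => ?_
    have := sin_pi_mul_div_pi_pos ha
    simp only [gammaKernel, Pi.zero_apply]
    positivity

lemma gammaPartialSum_eq_eulerMascheroniSeq (n : ℕ) :
    gammaPartialSum n = Real.eulerMascheroniSeq n := by
  induction n with
  | zero => simp [gammaPartialSum, Real.eulerMascheroniSeq]
  | succ n ih =>
    rw [gammaPartialSum, Finset.sum_Icc_succ_top (by omega), ← gammaPartialSum, ih,
      Real.eulerMascheroniSeq, Real.eulerMascheroniSeq, harmonic_succ,
      Real.log_div (by positivity) (by positivity)]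
    push_cast
    ring

lemma hasSum_eulerMascheroniConstant_sub (n : ℕ) :
    HasSum (fun i : ℕ => 1 / ((n + i : ℕ) + 1 : ℝ)
        - Real.log (((n + i : ℕ) + 2) / ((n + i : ℕ) + 1)))
      (Real.eulerMascheroniConstant - gammaPartialSum n) := by
  have hterm : ∀ k : ℕ, 1 / ((k : ℝ) + 1) - Real.log ((k + 2) / (k + 1)) =
      gammaPartialSum (k + 1) - gammaPartialSum k := by
    intro k
    rw [gammaPartialSum, Finset.sum_Icc_succ_top (by omega), ← gammaPartialSum]
    push_cast
    ring_nf
  rw [hasSum_iff_tendsto_nat_of_nonneg]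
  · have h : ∀ m : ℕ, ∑ i ∈ Finset.range m, (1 / ((n + i : ℕ) + 1 : ℝ)
        - Real.log (((n + i : ℕ) + 2) / ((n + i : ℕ) + 1))) =
        gammaPartialSum (m + n) - gammaPartialSum n := by
      intro m
      simp only [hterm]
      have := Finset.sum_range_sub (fun i => gammaPartialSum (n + i)) m
      simpa [add_assoc, add_comm m n] using this
    simp only [h]
    refine Filter.Tendsto.sub_const ?_ _
    have := (Filter.tendsto_add_atTop_iff_nat n).2 Real.tendsto_eulerMascheroniSeq
    simpa only [gammaPartialSum_eq_eulerMascheroniSeq] using this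
  · intro i
    rw [hterm, sub_nonneg, gammaPartialSum_eq_eulerMascheroniSeq,
      gammaPartialSum_eq_eulerMascheroniSeq]
    exact Real.strictMono_eulerMascheroniSeq.monotone (Nat.le_succ _)

lemma lintegral_pow_mul_one_sub_rpow (k : ℕ) {b : ℝ} (hb : 0 < b) :
    ∫⁻ x in Set.Ioo (0 : ℝ) 1, ENNReal.ofReal (x ^ k * (1 - x ^ b)) =
      ENNReal.ofReal (1 / (k + 1 : ℝ) - 1 / (k + 1 + b)) := by
  have hk : (0 : ℝ) ≤ k := Nat.cast_nonneg k
  have hcont : Continuous fun x : ℝ => x ^ b :=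
    continuous_id.rpow_const fun _ => Or.inr hb.le
  rw [← ofReal_integral_eq_lintegral_ofReal]
  · congr 1
    have h : ∫ x in Set.Ioo (0 : ℝ) 1, x ^ k * (1 - x ^ b) =
        ∫ x in Set.Ioo (0 : ℝ) 1, (x ^ (k : ℝ) - x ^ ((k : ℝ) + b)) := by
      refine setIntegral_congr_fun measurableSet_Ioo fun x hx => ?_
      simp only [Real.rpow_add hx.1, Real.rpow_natCast]
      ring
    rw [h, ← integral_Ioc_eq_integral_Ioo, ← intervalIntegral.integral_of_le zero_le_one,
      intervalIntegral.integral_sub, integral_rpow (Or.inl (by linarith)),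
      integral_rpow (Or.inl (by linarith)), Real.one_rpow, Real.one_rpow,
      Real.zero_rpow (by positivity), Real.zero_rpow (by positivity)]
    · ring
    · exact intervalIntegral.intervalIntegrable_rpow' (by linarith)
    · exact intervalIntegral.intervalIntegrable_rpow' (by linarith)
  · exact (Continuous.integrableOn_Icc (by fun_prop)).mono_set Set.Ioo_subset_Icc_self
  · refine ae_restrict_of_forall_mem measurableSet_Ioo fun x hx => ?_
    exact mul_nonneg (pow_nonneg hx.1.le _)
      (sub_nonneg.2 (Real.rpow_le_one hx.1.le hx.2.le hb.le))

lemma lintegral_inv_sub_inv (k : ℕ) :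
    ∫⁻ a in Set.Ioo (0 : ℝ) 1, ENNReal.ofReal (1 / (k + 1 : ℝ) - 1 / (k + 1 + (1 - a))) =
      ENNReal.ofReal (1 / (k + 1 : ℝ) - Real.log ((k + 2) / (k + 1))) := by
  have hk : (0 : ℝ) ≤ k := Nat.cast_nonneg k
  have hci : IntervalIntegrable (fun a : ℝ => 1 / ((k : ℝ) + 1 + (1 - a))) volume 0 1 := by
    refine ContinuousOn.intervalIntegrable fun a ha => ContinuousAt.continuousWithinAt ?_
    rw [Set.uIcc_of_le zero_le_one] at ha
    have : (k : ℝ) + 1 + (1 - a) ≠ 0 := by linarith [ha.2]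
    fun_prop (disch := assumption)
  rw [← ofReal_integral_eq_lintegral_ofReal]
  · rw [← integral_Ioc_eq_integral_Ioo, ← intervalIntegral.integral_of_le zero_le_one,
      intervalIntegral.integral_sub (by simp) hci]
    congr 2
    · simp
    · have := intervalIntegral.integral_comp_sub_left (a := 0) (b := 1)
        (fun y : ℝ => 1 / y) ((k : ℝ) + 1 + 1)
      simp only [← add_sub_assoc]
      rw [this, integral_one_div_of_pos (by linarith) (by linarith)]
      congr 1
      ring
  · rw [← IntegrableOn, ← integrableOn_Ioc_iff_integrableOn_Ioo,
      ← intervalIntegrable_iff_integrableOn_Ioc_of_le zero_le_one]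
    exact IntervalIntegrable.sub (by simp) hci
  · refine ae_restrict_of_forall_mem measurableSet_Ioo fun a ha => ?_
    simp only [Pi.zero_apply, sub_nonneg]
    exact one_div_le_one_div_of_le (by positivity) (by linarith [ha.2])

/-- Expand `1 / (1 - x)` geometrically and integrate termwise in `x`, then in `a`: the terms become
those of the series for `γ - S_n`. Everything is nonnegative, so Tonelli suffices. -/
lemma lintegral_lintegral_pow_mul_div (n : ℕ) :
    ∫⁻ a in Set.Ioo (0 : ℝ) 1, ∫⁻ x in Set.Ioo (0 : ℝ) 1,
        ENNReal.ofReal (x ^ n * ((1 - x ^ (1 - a)) / (1 - x))) =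
      ENNReal.ofReal (Real.eulerMascheroniConstant - gammaPartialSum n) := by
  have hsum := hasSum_eulerMascheroniConstant_sub n
  have hinner : ∀ a ∈ Set.Ioo (0 : ℝ) 1, ∫⁻ x in Set.Ioo (0 : ℝ) 1,
      ENNReal.ofReal (x ^ n * ((1 - x ^ (1 - a)) / (1 - x))) =
      ∑' i : ℕ, ENNReal.ofReal (1 / ((n + i : ℕ) + 1 : ℝ)
        - 1 / ((n + i : ℕ) + 1 + (1 - a))) := by
    intro a ha
    have ha1 := sub_pos.2 ha.2
    simp only [← lintegral_pow_mul_one_sub_rpow _ ha1]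
    rw [← lintegral_tsum fun i => by fun_prop]
    refine setLIntegral_congr_fun measurableSet_Ioo fun x hx => ?_
    have hx1 : 0 ≤ 1 - x ^ (1 - a) := sub_nonneg.2 (Real.rpow_le_one hx.1.le hx.2.le ha1.le)
    have hg := ((hasSum_geometric_of_lt_one hx.1.le hx.2).mul_left (x ^ n)).mul_right
      (1 - x ^ (1 - a))
    simp only [← pow_add] at hg
    rw [← ENNReal.ofReal_tsum_of_nonneg
      (fun i => mul_nonneg (pow_nonneg hx.1.le _) hx1) hg.summable, hg.tsum_eq]
    congr 1
    ring
  rw [setLIntegral_congr_fun measurableSet_Ioo hinner, lintegral_tsum fun i => by fun_prop]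
  simp only [lintegral_inv_sub_inv]
  rw [← ENNReal.ofReal_tsum_of_nonneg (fun i => ?_) hsum.summable, hsum.tsum_eq]
  have h := Real.log_le_sub_one_of_pos
    (show (0 : ℝ) < (((n + i : ℕ) + 2) / ((n + i : ℕ) + 1)) by positivity)
  have h2 : (((n + i : ℕ) + 2) / ((n + i : ℕ) + 1) : ℝ) - 1 = 1 / ((n + i : ℕ) + 1) := by
    field_simp
    ring
  linarith

/-- The integral representation of `γ - S_n`. -/
lemma lintegral_lintegral_omegaWeight (n : ℕ) :
    ∫⁻ x in Set.Ioo (0 : ℝ) 1, ∫⁻ t in Set.Ioo (0 : ℝ) 1,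
        ENNReal.ofReal (x ^ n * (omegaWeight t / (1 - t + x * t))) =
      ENNReal.ofReal (Real.eulerMascheroniConstant - gammaPartialSum n) := by
  rw [← lintegral_lintegral_pow_mul_div, lintegral_lintegral_swap
    (f := fun a x : ℝ => ENNReal.ofReal (x ^ n * ((1 - x ^ (1 - a)) / (1 - x))))
    (Measurable.aemeasurable (by fun_prop))]
  refine setLIntegral_congr_fun measurableSet_Ioo fun x hx => ?_
  have hxn : 0 ≤ x ^ n := pow_nonneg hx.1.le n
  simp only [ENNReal.ofReal_mul hxn]
  rw [lintegral_const_mul' _ _ ENNReal.ofReal_ne_top,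
    lintegral_const_mul' _ _ ENNReal.ofReal_ne_top]
  congr 1
  rw [← setLIntegral_congr_fun measurableSet_Ioo fun t ht => lintegral_gammaKernel_left hx ht,
    ← setLIntegral_congr_fun measurableSet_Ioo fun a ha => lintegral_gammaKernel_right ha hx,
    lintegral_lintegral_swap]
  refine Measurable.aemeasurable ?_
  simp only [gammaKernel, Function.uncurry_def]
  fun_prop

lemma integrable_pow_mul_omegaWeight_div (n : ℕ) :
    Integrable (fun p : ℝ × ℝ => p.1 ^ n * (omegaWeight p.2 / (1 - p.2 + p.1 * p.2)))
      ((volume.restrict (Set.Ioo (0 : ℝ) 1)).prod (volume.restrict (Set.Ioo (0 : ℝ) 1))) ∧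
    ∫ p, p.1 ^ n * (omegaWeight p.2 / (1 - p.2 + p.1 * p.2))
      ∂((volume.restrict (Set.Ioo (0 : ℝ) 1)).prod (volume.restrict (Set.Ioo (0 : ℝ) 1))) =
      Real.eulerMascheroniConstant - gammaPartialSum n := by
  have hmeas : Measurable
      (fun p : ℝ × ℝ => p.1 ^ n * (omegaWeight p.2 / (1 - p.2 + p.1 * p.2))) := by
    unfold omegaWeight
    fun_prop
  have hnonneg : 0 ≤ᵐ[(volume.restrict (Set.Ioo (0 : ℝ) 1)).prod
      (volume.restrict (Set.Ioo (0 : ℝ) 1))]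
      (fun p : ℝ × ℝ => p.1 ^ n * (omegaWeight p.2 / (1 - p.2 + p.1 * p.2))) := by
    rw [Measure.prod_restrict]
    refine ae_restrict_of_forall_mem (measurableSet_Ioo.prod measurableSet_Ioo) fun p hp => ?_
    have := omegaWeight_pos hp.2
    have := one_sub_add_mul_pos hp.2 hp.1.1.le
    have := hp.1.1
    simp only [Pi.zero_apply]
    positivity
  have hlint := lintegral_lintegral_omegaWeight n
  rw [← lintegral_prod (fun p : ℝ × ℝ =>
    ENNReal.ofReal (p.1 ^ n * (omegaWeight p.2 / (1 - p.2 + p.1 * p.2))))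
    hmeas.ennreal_ofReal.aemeasurable] at hlint
  refine ⟨⟨hmeas.aestronglyMeasurable, ?_⟩, ?_⟩
  · rw [hasFiniteIntegral_iff_ofReal hnonneg, hlint]
    exact ENNReal.ofReal_lt_top
  · rw [integral_eq_lintegral_of_nonneg_ae hnonneg hmeas.aestronglyMeasurable, hlint,
      ENNReal.toReal_ofReal]
    rw [gammaPartialSum_eq_eulerMascheroniSeq, sub_nonneg]
    exact (Real.eulerMascheroniSeq_lt_eulerMascheroniConstant n).le

lemma integral_omegaWeight_mul (n : ℕ) :
    IntegrableOn (fun t => omegaWeight t * ∫ x in (0 : ℝ)..1, x ^ n / (1 - t + x * t))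
      (Set.Ioo 0 1) ∧
    ∫ t in Set.Ioo (0 : ℝ) 1, omegaWeight t * ∫ x in (0 : ℝ)..1, x ^ n / (1 - t + x * t) =
      Real.eulerMascheroniConstant - gammaPartialSum n := by
  obtain ⟨hint, hval⟩ := integrable_pow_mul_omegaWeight_div n
  have heq : ∀ t : ℝ, omegaWeight t * ∫ x in (0 : ℝ)..1, x ^ n / (1 - t + x * t) =
      ∫ x in Set.Ioo (0 : ℝ) 1, x ^ n * (omegaWeight t / (1 - t + x * t)) := by
    intro t
    rw [← intervalIntegral.integral_const_mul, intervalIntegral.integral_of_le zero_le_one,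
      integral_Ioc_eq_integral_Ioo]
    congr 1 with x
    ring
  simp only [heq]
  refine ⟨hint.integral_prod_right, ?_⟩
  rw [← hval, integral_prod_symm _ hint]

/-! ### The linear form as an integral; blocks and binomials -/

lemma eulerIntegral_eq_sum (r N : ℕ) {t : ℝ} (ht : t ∈ Set.Ioo (0 : ℝ) 1) (C : Finset ℕ) (p : ℕ) :
    eulerIntegral r N t C p 1 = ∑ k ∈ Finset.range (N + 1),
      ((-1 : ℝ) ^ k * (N.choose k : ℝ) * ∏ c ∈ C, ((r : ℝ) * k + c)) *
        ∫ x in (0 : ℝ)..1, x ^ (r * k + p) / (1 - t + x * t) := by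
  simp only [← intervalIntegral.integral_const_mul]
  rw [← intervalIntegral.integral_finsetSum, eulerIntegral]
  · congr 1 with x
    rw [eulerPoly, Finset.sum_mul, Finset.sum_div]
    refine Finset.sum_congr rfl fun k _ => ?_
    rw [pow_add]
    ring
  · intro k _
    refine ContinuousOn.intervalIntegrable fun x hx => ContinuousAt.continuousWithinAt ?_
    rw [Set.uIcc_of_le zero_le_one] at hx
    have := (one_sub_add_mul_pos ht hx.1).ne'
    fun_prop (disch := assumption)

lemma sum_mul_eulerMascheroniConstant_sub (r N : ℕ) (C : Finset ℕ) (p : ℕ) :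
    ∑ k ∈ Finset.range (N + 1),
      ((-1 : ℝ) ^ k * (N.choose k : ℝ) * ∏ c ∈ C, ((r : ℝ) * k + c)) *
        (Real.eulerMascheroniConstant - gammaPartialSum (r * k + p)) =
      ∫ t in Set.Ioo (0 : ℝ) 1, omegaWeight t * eulerIntegral r N t C p 1 := by
  have h : ∫ t in Set.Ioo (0 : ℝ) 1, omegaWeight t * eulerIntegral r N t C p 1 =
      ∫ t in Set.Ioo (0 : ℝ) 1, ∑ k ∈ Finset.range (N + 1),
        ((-1 : ℝ) ^ k * (N.choose k : ℝ) * ∏ c ∈ C, ((r : ℝ) * k + c)) *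
          (omegaWeight t * ∫ x in (0 : ℝ)..1, x ^ (r * k + p) / (1 - t + x * t)) := by
    refine setIntegral_congr_fun measurableSet_Ioo fun t ht => ?_
    simp only [eulerIntegral_eq_sum r N ht, Finset.mul_sum]
    refine Finset.sum_congr rfl fun k _ => ?_
    ring
  rw [h, integral_finsetSum _ fun k _ => (integral_omegaWeight_mul (r * k + p)).1.const_mul _]
  refine Finset.sum_congr rfl fun k _ => ?_
  rw [integral_const_mul, (integral_omegaWeight_mul (r * k + p)).2]

lemma prod_Ioc_add_eq (y s q : ℕ) :
    ∏ c ∈ Finset.Ioc s (s + q), ((y : ℝ) + c) = q.factorial * ((y + q + s).choose q : ℝ) := by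
  induction q with
  | zero => simp
  | succ q ih =>
    rw [← add_assoc, Finset.prod_Ioc_succ_top (by omega), ih, Nat.factorial_succ,
      show y + (q + 1) + s = y + q + s + 1 by ring]
    have h := Nat.add_one_mul_choose_eq (y + q + s) q
    have h' : ((y + q + s : ℕ) + 1 : ℝ) * ((y + q + s).choose q : ℝ) =
        ((y + q + s + 1).choose (q + 1) : ℝ) * (q + 1) := by exact_mod_cast h
    push_cast at h' ⊢
    linear_combination (q.factorial : ℝ) * h'

lemma prod_Ioc_sub_eq (M s q : ℕ) (h : s + q ≤ M) :
    ∏ c ∈ Finset.Ioc s (s + q), ((M : ℝ) + 1 - c) = q.factorial * ((M - s).choose q : ℝ) := by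
  induction q with
  | zero => simp
  | succ q ih =>
    rw [← add_assoc, Finset.prod_Ioc_succ_top (by omega), ih (by omega), Nat.factorial_succ]
    have h1 := Nat.choose_succ_right_eq (M - s) q
    have h2 : ((M - s - q : ℕ) : ℝ) = M - s - q := by
      rw [Nat.cast_sub (by omega), Nat.cast_sub (by omega)]
    have h' : ((M - s).choose (q + 1) : ℝ) * (q + 1) = ((M - s).choose q : ℝ) * (M - s - q) := by
      rw [← h2]; exact_mod_cast h1
    push_cast
    linear_combination (-(q.factorial : ℝ)) * h'

/-- The union of the integer intervals `(τ_j, τ_j + n_j]` for `1 ≤ j ≤ m`. -/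
def blockUnion (n τ : ℕ → ℕ) (m : ℕ) : Finset ℕ :=
  (Finset.Icc 1 m).biUnion fun j => Finset.Ioc (τ j) (τ j + n j)

lemma block_lt {m : ℕ} {n τ : ℕ → ℕ} (hτ : ∀ j, 1 ≤ j → j < m → n j + τ j < τ (j + 1))
    {i j : ℕ} (hi : 1 ≤ i) (hij : i < j) (hj : j ≤ m) : n i + τ i < τ j := by
  induction j, hij using Nat.le_induction with
  | base => exact hτ i hi hj
  | succ j hij ih =>
    have h1 := ih (by omega)
    have h2 := hτ j (by omega) (by omega)
    omega

lemma pairwiseDisjoint_blocks {m : ℕ} {n τ : ℕ → ℕ}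
    (hτ : ∀ j, 1 ≤ j → j < m → n j + τ j < τ (j + 1)) :
    (↑(Finset.Icc 1 m) : Set ℕ).PairwiseDisjoint fun j => Finset.Ioc (τ j) (τ j + n j) := by
  intro i hi j hj hij
  rw [Finset.mem_coe, Finset.mem_Icc] at hi hj
  rw [Function.onFun, Finset.disjoint_left]
  intro c hci hcj
  rw [Finset.mem_Ioc] at hci hcj
  rcases lt_or_gt_of_ne hij with h | h
  · have := block_lt hτ hi.1 h hj.2
    omega
  · have := block_lt hτ hj.1 h hi.2
    omega

lemma card_blockUnion {m : ℕ} {n τ : ℕ → ℕ}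
    (hτ : ∀ j, 1 ≤ j → j < m → n j + τ j < τ (j + 1)) :
    (blockUnion n τ m).card = ∑ j ∈ Finset.Icc 1 m, n j := by
  rw [blockUnion, Finset.card_biUnion fun i hi j hj hij => pairwiseDisjoint_blocks hτ hi hj hij]
  simp

lemma prod_blockUnion {m : ℕ} {n τ : ℕ → ℕ}
    (hτ : ∀ j, 1 ≤ j → j < m → n j + τ j < τ (j + 1)) (f : ℕ → ℝ) :
    ∏ c ∈ blockUnion n τ m, f c =
      ∏ j ∈ Finset.Icc 1 m, ∏ c ∈ Finset.Ioc (τ j) (τ j + n j), f c :=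
  Finset.prod_biUnion (pairwiseDisjoint_blocks hτ)

lemma blockUnion_succ (n τ : ℕ → ℕ) (m : ℕ) :
    blockUnion n τ (m + 1) =
      blockUnion n τ m ∪ Finset.Ioc (τ (m + 1)) (τ (m + 1) + n (m + 1)) := by
  rw [blockUnion, blockUnion, ← Finset.insert_Icc_right_eq_Icc_add_one (by omega),
    Finset.biUnion_insert, Finset.union_comm]

lemma prod_factorial_mul_gammaLinearForm {m r : ℕ} {n τ : ℕ → ℕ} (hr : 1 ≤ r)
    (hτ : ∀ j, 1 ≤ j → j < m → n j + τ j < τ (j + 1)) :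
    (∏ j ∈ Finset.Icc 1 m, ((n j).factorial : ℝ)) * gammaLinearForm m r n τ =
      ∫ t in Set.Ioo (0 : ℝ) 1, omegaWeight t *
        eulerIntegral r (∑ j ∈ Finset.Icc 1 m, n j) t (blockUnion n τ m) (τ 0) 1 := by
  have hD : (∏ j ∈ Finset.Icc 1 m, ((n j).factorial : ℝ)) ≠ 0 :=
    Finset.prod_ne_zero_iff.2 fun j _ => by positivity
  have hlead := sum_neg_one_pow_mul_choose_mul_prod hr (blockUnion n τ m)
  rw [card_blockUnion hτ] at hlead
  rw [← sum_mul_eulerMascheroniConstant_sub, gammaLinearForm, ← hlead, mul_sub, div_mul_eq_mul_div,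
    mul_div_cancel₀ _ hD, Finset.sum_mul, Finset.mul_sum, ← Finset.sum_sub_distrib]
  refine Finset.sum_congr rfl fun k _ => ?_
  have hprod : ∏ c ∈ blockUnion n τ m, ((r : ℝ) * k + c) =
      (∏ j ∈ Finset.Icc 1 m, ((n j).factorial : ℝ)) *
        ∏ j ∈ Finset.Icc 1 m, ((r * k + n j + τ j).choose (n j) : ℝ) := by
    rw [prod_blockUnion hτ, ← Finset.prod_mul_distrib]
    refine Finset.prod_congr rfl fun j _ => ?_
    rw [← prod_Ioc_add_eq]
    push_cast
    rfl
  rw [hprod]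
  ring

/-! ### Pointwise estimate and conclusion -/

lemma abs_eulerIntegral_blockUnion_le {m r : ℕ} {n τ : ℕ → ℕ} (hm : 1 ≤ m)
    (hτ_low : τ m ≤ τ 0) (hτ_up : τ 0 ≤ n m + τ m)
    (hτ : ∀ j, 1 ≤ j → j < m → n j + τ j < τ (j + 1)) {t : ℝ} (ht : t ∈ Set.Ioo (0 : ℝ) 1) :
    |eulerIntegral r (∑ j ∈ Finset.Icc 1 m, n j) t (blockUnion n τ m) (τ 0) 1| ≤
      (∏ j ∈ Finset.Icc 1 m, ((n j).factorial * ((n m + τ m - τ j).choose (n j) : ℝ))) *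
        (t ^ (n m + τ m - τ 0) * (1 - t) ^ (τ 0 - τ m) *
          eulerIntegral r (∑ j ∈ Finset.Icc 1 m, n j) t ∅ (n m + τ m) (n m + 1)) := by
  obtain ⟨m, rfl⟩ := Nat.exists_eq_add_of_le' hm
  obtain ⟨e, he⟩ := Nat.exists_eq_add_of_le hτ_low
  obtain ⟨q, hq⟩ := Nat.exists_eq_add_of_le hτ_up
  have hnm : n (m + 1) = e + q := by omega
  have hτ' : ∀ j, 1 ≤ j → j < m → n j + τ j < τ (j + 1) := fun j h1 h2 => hτ j h1 (by omega)
  have hle : ∀ c ∈ blockUnion n τ m, c ≤ τ (m + 1) := by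
    intro c hc
    simp only [blockUnion, Finset.mem_biUnion, Finset.mem_Icc, Finset.mem_Ioc] at hc
    obtain ⟨j, hj, hcj⟩ := hc
    have := block_lt hτ hj.1 (Nat.lt_add_one_of_le hj.2) le_rfl
    omega
  have hN : (blockUnion n τ m).card + n (m + 1) = ∑ j ∈ Finset.Icc 1 (m + 1), n j := by
    rw [card_blockUnion hτ', Finset.sum_Icc_succ_top (by omega)]
  generalize ∑ j ∈ Finset.Icc 1 (m + 1), n j = N at hN
  have hdisj : ∀ a b, τ (m + 1) ≤ a → Disjoint (blockUnion n τ m) (Finset.Ioc a b) := by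
    intro a b ha
    rw [Finset.disjoint_left]
    intro c hc hc'
    have := hle c hc
    rw [Finset.mem_Ioc] at hc'
    omega
  -- The last block is cut at `τ 0 = τ (m + 1) + e`.
  have hunion : blockUnion n τ (m + 1) = (blockUnion n τ m ∪
      Finset.Ioc (τ (m + 1)) (τ (m + 1) + e)) ∪ Finset.Ioc (τ 0) (τ 0 + q) := by
    rw [blockUnion_succ, Finset.union_assoc]
    congr 1
    ext c
    simp only [Finset.mem_union, Finset.mem_Ioc]
    omega
  have hd2 : Disjoint (blockUnion n τ m ∪ Finset.Ioc (τ (m + 1)) (τ (m + 1) + e))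
      (Finset.Ioc (τ 0) (τ 0 + q)) := by
    rw [Finset.disjoint_union_left]
    refine ⟨hdisj _ _ hτ_low, ?_⟩
    rw [Finset.disjoint_left]
    intro c hc hc'
    rw [Finset.mem_Ioc] at hc hc'
    omega
  have hcard2 : (blockUnion n τ m ∪ Finset.Ioc (τ (m + 1)) (τ (m + 1) + e)).card + q ≤ N := by
    have := Finset.card_union_le (blockUnion n τ m) (Finset.Ioc (τ (m + 1)) (τ (m + 1) + e))
    simp only [Nat.card_Ioc] at this
    omega
  -- The upper part goes first: it raises the exponent to `τ 0 + q` and the denominator power to `q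
  -- + 1`, exactly the shape needed to remove the lower part with `b = q`.
  have h1 := eulerIntegral_union_Ioc_up r N ht q (τ 0) 0 hd2 hcard2
  have h2 := eulerIntegral_union_Ioc_down r N ht (τ (m + 1)) e q (hdisj _ _ le_rfl) (by omega)
  have hbound := abs_eulerIntegral_le r N ht (n (m + 1) + τ (m + 1)) (blockUnion n τ m)
    (n (m + 1) + 1) (fun c hc => by have := hle c hc; omega) (by omega)
  have hprod : ∏ c ∈ blockUnion n τ m, (((n (m + 1) + τ (m + 1) : ℕ) : ℝ) + 1 - c) =
      ∏ j ∈ Finset.Icc 1 m,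
        ((n j).factorial * ((n (m + 1) + τ (m + 1) - τ j).choose (n j) : ℝ)) := by
    rw [prod_blockUnion hτ']
    refine Finset.prod_congr rfl fun j hj => prod_Ioc_sub_eq _ _ _ ?_
    rw [Finset.mem_Icc] at hj
    have := block_lt hτ hj.1 (Nat.lt_add_one_of_le hj.2) le_rfl
    omega
  rw [hprod] at hbound
  rw [← hunion, Nat.factorial_zero, Nat.cast_one, one_mul, zero_add, zero_add] at h1
  rw [show τ 0 + q = τ (m + 1) + e + q by omega] at h1
  rw [show τ (m + 1) + e + q = n (m + 1) + τ (m + 1) by omega,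
    show q + e = n (m + 1) by omega] at h2
  rw [show τ (m + 1) + e + q = n (m + 1) + τ (m + 1) by omega] at h1
  have h3 : eulerIntegral r N t (blockUnion n τ (m + 1)) (τ 0) 1 =
      (-1) ^ e * ((n (m + 1)).factorial * t ^ q * (1 - t) ^ e) *
        eulerIntegral r N t (blockUnion n τ m) (n (m + 1) + τ (m + 1)) (n (m + 1) + 1) := by
    rw [neg_pow] at h2
    linear_combination h1 + t ^ q * h2
  have ht0 := ht.1.le
  have ht1 := (sub_pos.2 ht.2).le
  rw [h3, abs_mul, abs_mul, abs_pow, abs_neg, abs_one, one_pow, one_mul,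
    abs_of_nonneg (by positivity), Finset.prod_Icc_succ_top (by omega), Nat.add_sub_cancel,
    Nat.choose_self, show n (m + 1) + τ (m + 1) - τ 0 = q by omega,
    show τ 0 - τ (m + 1) = e by omega]
  refine (mul_le_mul_of_nonneg_left hbound (by positivity)).trans_eq ?_
  push_cast
  ring

lemma integral_errorIntegrand (m r : ℕ) (n τ : ℕ → ℕ) (t : ℝ) :
    ∫ x in (0 : ℝ)..1, errorIntegrand m r n τ x t =
      omegaWeight t * (t ^ (n m + τ m - τ 0) * (1 - t) ^ (τ 0 - τ m) *
        eulerIntegral r (∑ j ∈ Finset.Icc 1 m, n j) t ∅ (n m + τ m) (n m + 1)) := by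
  rw [eulerIntegral, ← intervalIntegral.integral_const_mul, ← intervalIntegral.integral_const_mul]
  congr 1 with x
  rw [eulerPoly_empty, errorIntegrand]
  ring

lemma integrable_errorIntegrand {m r : ℕ} {n τ : ℕ → ℕ} (hτ_low : τ m ≤ τ 0)
    (hτ_up : τ 0 ≤ n m + τ m) :
    Integrable (fun p : ℝ × ℝ => errorIntegrand m r n τ p.1 p.2)
      ((volume.restrict (Set.Ioo (0 : ℝ) 1)).prod (volume.restrict (Set.Ioo (0 : ℝ) 1))) := by
  -- The majorant is `ω(t) / (1 - t + x t)`: both `x t` and `1 - t` are at most the denominator,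
  -- which absorbs its `n_m` extra powers.
  refine (integrable_pow_mul_omegaWeight_div 0).1.mono' ?_ ?_
  · refine Measurable.aestronglyMeasurable ?_
    unfold errorIntegrand omegaWeight
    fun_prop
  rw [Measure.prod_restrict]
  refine ae_restrict_of_forall_mem (measurableSet_Ioo.prod measurableSet_Ioo) ?_
  rintro ⟨x, t⟩ ⟨hx, ht⟩
  simp only at hx ht
  obtain ⟨e, he⟩ := Nat.exists_eq_add_of_le hτ_low
  obtain ⟨q, hq⟩ := Nat.exists_eq_add_of_le hτ_up
  have hω := omegaWeight_pos ht
  have hD := one_sub_add_mul_pos ht hx.1.le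
  have hx0 := hx.1.le
  have ht0 := ht.1.le
  have ht1 : 0 ≤ 1 - t := (sub_pos.2 ht.2).le
  have hxr : 0 ≤ 1 - x ^ r := sub_nonneg.2 (pow_le_one₀ hx0 hx.2.le)
  simp only [errorIntegrand, pow_zero, one_mul]
  rw [Real.norm_of_nonneg (by positivity), show n m + τ m - τ 0 = q by omega,
    show τ 0 - τ m = e by omega, show n m = q + e by omega,
    show q + e + τ m = q + (e + τ m) by ring, pow_succ, pow_add, pow_add (1 - t + x * t)]
  rw [div_le_div_iff₀ (by positivity) hD]
  have h1 : x ^ q * t ^ q ≤ (1 - t + x * t) ^ q := by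
    rw [← mul_pow]
    exact pow_le_pow_left₀ (by positivity) (by linarith) _
  have h2 : (1 - t) ^ e ≤ (1 - t + x * t) ^ e :=
    pow_le_pow_left₀ ht1 (by have := mul_nonneg hx0 ht0; linarith) _
  have h3 : x ^ (e + τ m) ≤ 1 := pow_le_one₀ hx0 hx.2.le
  have h4 : (1 - x ^ r) ^ (∑ j ∈ Finset.Icc 1 m, n j) ≤ 1 :=
    pow_le_one₀ hxr (by have := pow_nonneg hx0 r; linarith)
  calc _ = (x ^ q * t ^ q) * (1 - t) ^ e * (x ^ (e + τ m) *
        (1 - x ^ r) ^ (∑ j ∈ Finset.Icc 1 m, n j)) * (omegaWeight t * (1 - t + x * t)) := by ring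
    _ ≤ (1 - t + x * t) ^ q * (1 - t + x * t) ^ e * (1 * 1) *
        (omegaWeight t * (1 - t + x * t)) := by gcongr
    _ = _ := by ring

theorem theorem4 (m r : ℕ) (n τ : ℕ → ℕ) (hm : 1 ≤ m) (hr : 1 ≤ r)
    (hn : ∀ j, 1 ≤ j → j ≤ m → 1 ≤ n j)
    (hτ_low : τ m ≤ τ 0) (hτ_up : τ 0 ≤ n m + τ m)
    (hτ : ∀ j, 1 ≤ j → j < m → τ (j + 1) ≤ n m + τ m ∧ n j + τ j < τ (j + 1)) :
    IntegrableOn (fun p : ℝ × ℝ => errorIntegrand m r n τ p.1 p.2)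
        (Set.Ioo (0 : ℝ) 1 ×ˢ Set.Ioo (0 : ℝ) 1) ∧
      |gammaLinearForm m r n τ| ≤
        (∏ j ∈ Finset.Icc 1 m, ((n m + τ m - τ j).choose (n j) : ℝ))
          * ∫ t in (0 : ℝ)..1, ∫ x in (0 : ℝ)..1, errorIntegrand m r n τ x t := by
  have hint := integrable_errorIntegrand (r := r) hτ_low hτ_up
  have hτ' : ∀ j, 1 ≤ j → j < m → n j + τ j < τ (j + 1) := fun j h1 h2 => (hτ j h1 h2).2
  refine ⟨by rwa [IntegrableOn, Measure.volume_eq_prod, ← Measure.prod_restrict], ?_⟩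
  have hD : 0 < ∏ j ∈ Finset.Icc 1 m, ((n j).factorial : ℝ) :=
    Finset.prod_pos fun j _ => by positivity
  have hintt : IntegrableOn (fun t => ∫ x in (0 : ℝ)..1, errorIntegrand m r n τ x t)
      (Set.Ioo 0 1) := by
    simp only [intervalIntegral.integral_of_le zero_le_one, integral_Ioc_eq_integral_Ioo]
    exact hint.integral_prod_right
  rw [intervalIntegral.integral_of_le zero_le_one, integral_Ioc_eq_integral_Ioo]
  refine le_of_mul_le_mul_left ?_ hD
  rw [← mul_assoc, ← Finset.prod_mul_distrib, ← integral_const_mul, ← abs_of_pos hD, ← abs_mul,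
    prod_factorial_mul_gammaLinearForm hr hτ', ← Real.norm_eq_abs]
  refine norm_integral_le_of_norm_le (hintt.const_mul _)
    (ae_restrict_of_forall_mem measurableSet_Ioo fun t ht => ?_)
  have hω := omegaWeight_pos ht
  rw [Real.norm_eq_abs, abs_mul, abs_of_pos hω, integral_errorIntegrand, mul_left_comm]
  exact mul_le_mul_of_nonneg_left
    (abs_eulerIntegral_blockUnion_le hm hτ_low hτ_up hτ' ht) hω.le
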